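/- Let $n\in\mathbb N$ and let $\mu$ be a Borel probability measure on $\mathbb R^{n\times n}$ whose support $\mathcal M=\operatorname{supp}\mu$ is bounded. Let $\|\cdot\|$ denote the Euclidean norm on $\mathbb R^n$. Assume: (A2) $\mathcal M$ leaves a proper cone invariant, i.e. there is a set $K\subset\mathbb R^n$ that is closed under multiplication by nonnegative numbers, closed, convex, has nonempty interior, satisfies $K\cap(-K)=\{0\}$, and is such that $AK\subset K$ for every $A\in\mathcal M$; (A3) the singular part $\mu_s$ of $\mu$ with respect to Lebesgue measure on $\mathbb R^{n\times n}$ is either $0$ or of the form $\mu_s=p_1\delta_{M_1}+\dots+p_N\delta_{M_N}$ with $p_1,\dots,p_N>0$ and $M_1,\dots,M_N\in\mathbb R^{n\times n}$, where $\delta_M$ is the Dirac measure at $M$. The switched linear system $\Sigma_{\mathcal M}$: $x(k+1)=A_kx(k)$, $A_k\in\mathcal M$, $x(0)=x_0$, is called *absolutely exponentially stable* if there exist $C>0$ and $\gamma\in[0,1)$ such that $\|x(k)\|\le C\gamma^k\|x_0\|$ for all $k\ge 0$, all $\mathcal M$-valued sequences $\{A_k\}_{k\ge0}$ and all $x_0\in\mathbb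 R^n$. For an integer $p\ge1$, a function $V:\mathbb R^n\to\mathbb R$ is called a *stochastic Lyapunov function of degree $p$ with growth rate $\gamma\in[0,1)$* for the stochastic system $\Sigma_\mu$: $x(k+1)=A_kx(k)$, with the $A_k$ independent and distributed according to $\mu$, if there exist $C_1,C_2>0$ such that, for every $x\in\mathbb R^n$, $$C_1\|x\|^p\le V(x)\le C_2\|x\|^p ,\qquad E[V(Ax)]\le\gamma^pV(x),$$ where $A$ is distributed according to $\mu$ and $V(Ax)$ is integrable for every $x$. Then $\Sigma_{\mathcal M}$ is absolutely exponentially stable if and only if there exists $\gamma<1$ such that, for every integer $p\ge1$, $\Sigma_\mu$ admits a stochastic Lyapunov function of degree $p$ with growth rate at most $\gamma$. -/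

import Mathlib

open MeasureTheory
open scoped Matrix.Norms.L2Operator

namespace SwitchedLinear

/-! Real matrices carry the spectral norm (maximal singular value), through the scoped instances
opened above; its topology is the usual one.  Vectors live in `EuclideanSpace ℝ (Fin n)`. -/

/-- The (Borel) σ-algebra on real matrices, generated by the entries. -/
instance matrixMeasurableSpace (n : ℕ) : MeasurableSpace (Matrix (Fin n) (Fin n) ℝ) :=
  inferInstanceAs (MeasurableSpace (Fin n → Fin n → ℝ))

instance matrixBorelSpace (n : ℕ) : BorelSpace (Matrix (Fin n) (Fin n) ℝ) :=
  inferInstanceAs (BorelSpace (Fin n → Fin n → ℝ))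

/-- Lebesgue measure on the space of real `n × n` matrices (the product of the Lebesgue measures
of the entries). -/
noncomputable instance matrixMeasureSpace (n : ℕ) : MeasureSpace (Matrix (Fin n) (Fin n) ℝ) where
  volume := (volume : Measure (Fin n → Fin n → ℝ)).map Matrix.of

theorem matrix_volume_eq (n : ℕ) : (volume : Measure (Matrix (Fin n) (Fin n) ℝ)) =
    (volume : Measure (Fin n → Fin n → ℝ)) :=
  Measure.map_id

instance matrixVolumeSigmaFinite (n : ℕ) :
    SigmaFinite (volume : Measure (Matrix (Fin n) (Fin n) ℝ)) := by
  rw [matrix_volume_eq]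
  exact inferInstanceAs (SigmaFinite (volume : Measure (Fin n → Fin n → ℝ)))

/-- A cone (closed under multiplication by nonnegative numbers) that is closed, convex, solid and
pointed. -/
structure IsProperCone {n : ℕ} (K : Set (EuclideanSpace ℝ (Fin n))) : Prop where
  smul_mem : ∀ c : ℝ, 0 ≤ c → ∀ x ∈ K, c • x ∈ K
  isClosed : IsClosed K
  convex : Convex ℝ K
  solid : (interior K).Nonempty
  pointed : ∀ x, x ∈ K → -x ∈ K → x = 0

/-- The set `M` of matrices leaves the set `K` invariant: `A K ⊆ K` for each `A ∈ M`. -/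
def LeavesInvariant {n : ℕ} (M : Set (Matrix (Fin n) (Fin n) ℝ))
    (K : Set (EuclideanSpace ℝ (Fin n))) : Prop :=
  ∀ A ∈ M, ∀ x ∈ K, A.toEuclideanLin x ∈ K

/-- The singular part of `μ` with respect to Lebesgue measure is a linear combination, with positive
coefficients, of finitely many Dirac measures (`N = 0` is the case where it vanishes). -/
def SingularPartFinitelyAtomic {n : ℕ} (μ : Measure (Matrix (Fin n) (Fin n) ℝ)) : Prop :=
  ∃ (N : ℕ) (p : Fin N → ℝ) (M : Fin N → Matrix (Fin n) (Fin n) ℝ), (∀ i, 0 < p i) ∧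
    μ.singularPart volume = ∑ i, ENNReal.ofReal (p i) • Measure.dirac (M i)

/-- `x` is the trajectory of `x(k+1) = A_k x(k)`, `x(0) = x₀`. -/
def IsTrajectory {n : ℕ} (A : ℕ → Matrix (Fin n) (Fin n) ℝ) (x₀ : EuclideanSpace ℝ (Fin n))
    (x : ℕ → EuclideanSpace ℝ (Fin n)) : Prop :=
  x 0 = x₀ ∧ ∀ k, x (k + 1) = (A k).toEuclideanLin (x k)

/-- Absolute exponential stability of the switched linear system
`x(k+1) = A_k x(k)`, `A_k ∈ M`. -/
def AbsolutelyExponentiallyStable {n : ℕ} (M : Set (Matrix (Fin n) (Fin n) ℝ)) : Prop :=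
  ∃ C γ : ℝ, 0 < C ∧ 0 ≤ γ ∧ γ < 1 ∧
    ∀ A : ℕ → Matrix (Fin n) (Fin n) ℝ, (∀ k, A k ∈ M) →
      ∀ (x₀ : EuclideanSpace ℝ (Fin n)) (x : ℕ → EuclideanSpace ℝ (Fin n)),
        IsTrajectory A x₀ x → ∀ k, ‖x k‖ ≤ C * γ ^ k * ‖x₀‖

/-- `V` is a stochastic Lyapunov function of degree `p` with growth rate `γ` for the stochastic
switched linear system `x(k+1) = A_k x(k)`, where the `A_k` follow `μ` independently.  The expected
value `E[V(Ax)]`, with `A` following `μ`, is required to exist. -/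
structure IsStochasticLyapunov {n : ℕ} (μ : Measure (Matrix (Fin n) (Fin n) ℝ)) (p : ℕ) (γ : ℝ)
    (V : EuclideanSpace ℝ (Fin n) → ℝ) : Prop where
  rate_nonneg : 0 ≤ γ
  rate_lt_one : γ < 1
  norm_bounds : ∃ C₁ C₂ : ℝ, 0 < C₁ ∧ 0 < C₂ ∧
    ∀ x, C₁ * ‖x‖ ^ p ≤ V x ∧ V x ≤ C₂ * ‖x‖ ^ p
  integrable : ∀ x, Integrable (fun A => V (A.toEuclideanLin x)) μ
  decrease : ∀ x, ∫ A, V (A.toEuclideanLin x) ∂μ ≤ γ ^ p * V x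

end SwitchedLinear

/-! Stability gives Lyapunov functions through an adapted norm `v` that every matrix of the support
contracts by the same `c < 1`: `v ^ p` then decreases almost surely, at the rate `c` for every `p`.

For the converse, call `X ≥ T` when `X - T` maps `K` into itself. Replace `V` by its lower envelope
`W` in the order of `K`. If `X ≥ T` with positive probability `q`, the decrease of `V` in mean gives
`q * W (T x) ≤ γ ^ p * W x` on `K` (`mul_lowerEnvelope_le`). For a product `B` of matrices from
`dominatedSupport`, this yields a loss factor that does not depend on `p`. For large `p` its `p`-th
root is close to one, so the powers of `B` decay at a rate `β < 1` common to all products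
(`powersDecay_transition`).

A bounded set with this property is exponentially stable (`exists_growthBound_lt_one`). Normalise a
norm by a growth rate `c ≥ 1`. An orbit that stays large consists of separated points, because by
Cayley–Hamilton each product moves vectors by a fixed proportion. Packing bounds its length
independently of the norm, so `c` improves by a factor that depends only on `β` and `n`, and
iterating brings it below one.

Finally `dominatedSupport` is dense in the support, which is where the form of the singular part
enters, and growth bounds pass to closures. -/

namespace SwitchedLinear

variable {n : ℕ}

/-! ### Action of matrices on Euclidean space -/

theorem toEuclideanLin_mul_apply (A B : Matrix (Fin n) (Fin n) ℝ) (x : EuclideanSpace ℝ (Fin n)) :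
    (A * B).toEuclideanLin x = A.toEuclideanLin (B.toEuclideanLin x) := by
  simp [Matrix.toLpLin_apply, Matrix.mulVec_mulVec]

theorem toEuclideanLin_one_apply (x : EuclideanSpace ℝ (Fin n)) :
    (1 : Matrix (Fin n) (Fin n) ℝ).toEuclideanLin x = x := by
  simp

theorem norm_toEuclideanLin_le (A : Matrix (Fin n) (Fin n) ℝ) (x : EuclideanSpace ℝ (Fin n)) :
    ‖A.toEuclideanLin x‖ ≤ ‖A‖ * ‖x‖ :=
  Matrix.l2_opNorm_mulVec A x

theorem norm_le_of_forall_toEuclideanLin_le {A : Matrix (Fin n) (Fin n) ℝ} {c : ℝ} (hc : 0 ≤ c)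
    (h : ∀ x : EuclideanSpace ℝ (Fin n), ‖A.toEuclideanLin x‖ ≤ c * ‖x‖) : ‖A‖ ≤ c := by
  rw [Matrix.l2_opNorm_def]
  exact ContinuousLinearMap.opNorm_le_bound _ hc h

theorem continuous_toEuclideanLin_apply (x : EuclideanSpace ℝ (Fin n)) :
    Continuous fun A : Matrix (Fin n) (Fin n) ℝ => A.toEuclideanLin x :=
  ((LinearMap.applyₗ x).comp Matrix.toEuclideanLin.toLinearMap).continuous_of_finiteDimensional

/-! ### Transition matrices -/

/-- The transition matrix `A (k - 1) * ⋯ * A 0`. -/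
noncomputable def transition (A : ℕ → Matrix (Fin n) (Fin n) ℝ) : ℕ → Matrix (Fin n) (Fin n) ℝ
  | 0 => 1
  | k + 1 => A k * transition A k

theorem transition_add (A : ℕ → Matrix (Fin n) (Fin n) ℝ) (i k : ℕ) :
    transition A (i + k) = transition (fun j => A (i + j)) k * transition A i := by
  induction k with
  | zero => simp [transition]
  | succ k ih => rw [← add_assoc, transition, ih, transition, mul_assoc]

theorem transition_smul (c : ℝ) (A : ℕ → Matrix (Fin n) (Fin n) ℝ) (k : ℕ) :
    transition (fun j => c • A j) k = c ^ k • transition A k := by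
  induction k with
  | zero => simp [transition]
  | succ k ih => rw [transition, ih, transition, smul_mul_smul_comm, pow_succ']

theorem continuous_transition (k : ℕ) :
    Continuous fun A : ℕ → Matrix (Fin n) (Fin n) ℝ => transition A k := by
  induction k with
  | zero => exact continuous_const
  | succ k ih => exact (continuous_apply k).mul ih

theorem norm_transition_apply_le {A : ℕ → Matrix (Fin n) (Fin n) ℝ} {L : ℝ} (hL : 0 ≤ L)
    (hA : ∀ k, ‖A k‖ ≤ L) (k : ℕ) (x : EuclideanSpace ℝ (Fin n)) :
    ‖(transition A k).toEuclideanLin x‖ ≤ L ^ k * ‖x‖ := by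
  induction k with
  | zero => simp [transition]
  | succ k ih =>
    rw [transition, toEuclideanLin_mul_apply, pow_succ', mul_assoc]
    exact (norm_toEuclideanLin_le _ _).trans (mul_le_mul (hA k) ih (norm_nonneg _) hL)

theorem IsTrajectory.eq_transition {A : ℕ → Matrix (Fin n) (Fin n) ℝ}
    {x₀ : EuclideanSpace ℝ (Fin n)} {x : ℕ → EuclideanSpace ℝ (Fin n)} (h : IsTrajectory A x₀ x)
    (k : ℕ) : x k = (transition A k).toEuclideanLin x₀ := by
  induction k with
  | zero => rw [transition, toEuclideanLin_one_apply, h.1]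
  | succ k ih => rw [h.2, ih, transition, toEuclideanLin_mul_apply]

theorem isTrajectory_transition (A : ℕ → Matrix (Fin n) (Fin n) ℝ)
    (x₀ : EuclideanSpace ℝ (Fin n)) :
    IsTrajectory A x₀ fun k => (transition A k).toEuclideanLin x₀ :=
  ⟨toEuclideanLin_one_apply x₀, fun _ => toEuclideanLin_mul_apply _ _ _⟩

/-- Products of `k` matrices from `D` are bounded by a multiple of `c ^ k`. -/
def GrowthBound (D : Set (Matrix (Fin n) (Fin n) ℝ)) (c : ℝ) : Prop :=
  ∃ C : ℝ, ∀ A : ℕ → Matrix (Fin n) (Fin n) ℝ, (∀ k, A k ∈ D) →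
    ∀ (k : ℕ) (x : EuclideanSpace ℝ (Fin n)),
      ‖(transition A k).toEuclideanLin x‖ ≤ C * c ^ k * ‖x‖

theorem absolutelyExponentiallyStable_iff {D : Set (Matrix (Fin n) (Fin n) ℝ)} :
    AbsolutelyExponentiallyStable D ↔ ∃ c : ℝ, 0 < c ∧ c < 1 ∧ GrowthBound D c := by
  constructor
  · rintro ⟨C, γ, hC, hγ0, hγ1, h⟩
    -- The rate is kept positive because the adapted norm divides by its powers.
    refine ⟨max γ (1 / 2), by positivity, max_lt hγ1 (by norm_num), C, fun A hA k x => ?_⟩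
    refine (h A hA x _ (isTrajectory_transition A x) k).trans ?_
    gcongr
    exact le_max_left _ _
  · rintro ⟨c, hc0, hc1, C, h⟩
    refine ⟨max C 1, c, by positivity, hc0.le, hc1, fun A hA x₀ x hx k => ?_⟩
    rw [hx.eq_transition]
    refine (h A hA k x₀).trans ?_
    gcongr
    exact le_max_left _ _

/-- For fixed `k` and `x` the bound is a closed condition on the sequence in the product topology,
and the closure of a product of sets is the product of the closures. -/
theorem GrowthBound.closure {D : Set (Matrix (Fin n) (Fin n) ℝ)} {c : ℝ} (h : GrowthBound D c) :
    GrowthBound (closure D) c := by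
  obtain ⟨C, h⟩ := h
  refine ⟨C, fun A hA k x => ?_⟩
  have hcont : Continuous fun A : ℕ → Matrix (Fin n) (Fin n) ℝ =>
      ‖(transition A k).toEuclideanLin x‖ :=
    ((continuous_toEuclideanLin_apply x).comp (continuous_transition k)).norm
  have hcl : IsClosed {A : ℕ → Matrix (Fin n) (Fin n) ℝ |
      ‖(transition A k).toEuclideanLin x‖ ≤ C * c ^ k * ‖x‖} :=
    isClosed_le hcont continuous_const
  have hsub : Set.univ.pi (fun _ : ℕ => D) ⊆ {A : ℕ → Matrix (Fin n) (Fin n) ℝ |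
      ‖(transition A k).toEuclideanLin x‖ ≤ C * c ^ k * ‖x‖} :=
    fun A hA => h A (fun k => hA k trivial) k x
  refine closure_minimal hsub hcl ?_
  rw [closure_pi_set]
  exact fun k _ => hA k

/-- A set of matrices with growth rate `c` admits a norm that each of its elements increases at most
by the factor `c`. -/
theorem GrowthBound.exists_seminorm {D : Set (Matrix (Fin n) (Fin n) ℝ)} (hD : D.Nonempty) {c : ℝ}
    (hc : 0 < c) (h : GrowthBound D c) :
    ∃ (v : Seminorm ℝ (EuclideanSpace ℝ (Fin n))) (C : ℝ), 0 < C ∧ (∀ x, ‖x‖ ≤ v x) ∧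
      (∀ x, v x ≤ C * ‖x‖) ∧ ∀ A ∈ D, ∀ x, v (A.toEuclideanLin x) ≤ c * v x := by
  obtain ⟨C, h⟩ := h
  let ι := {A : ℕ → Matrix (Fin n) (Fin n) ℝ // ∀ k, A k ∈ D} × ℕ
  obtain ⟨A₀, hA₀⟩ := hD
  have : Nonempty ι := ⟨⟨⟨fun _ => A₀, fun _ => hA₀⟩, 0⟩⟩
  -- The norm is the supremum of these normalised orbit lengths. Length `0` gives `‖x‖ ≤ v x`, and
  -- the growth bound makes the supremum finite.
  let f : ι → EuclideanSpace ℝ (Fin n) → ℝ := fun i x =>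
    (c ^ i.2)⁻¹ * ‖(transition i.1.1 i.2).toEuclideanLin x‖
  have hf : ∀ i x, f i x ≤ C * ‖x‖ := fun i x => by
    have := h i.1.1 i.1.2 i.2 x
    have hp : 0 < c ^ i.2 := by positivity
    simp only [f]
    rw [inv_mul_le_iff₀ hp]
    linarith
  have hbdd : ∀ x, BddAbove (Set.range fun i => f i x) := fun x =>
    ⟨C * ‖x‖, by rintro _ ⟨i, rfl⟩; exact hf i x⟩
  let v : Seminorm ℝ (EuclideanSpace ℝ (Fin n)) := Seminorm.of (fun x => ⨆ i, f i x)
    (fun x y => ciSup_le fun i => by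
      refine le_trans ?_ (add_le_add (le_ciSup (hbdd x) i) (le_ciSup (hbdd y) i))
      simp only [f]
      rw [map_add, ← mul_add]
      gcongr
      exact norm_add_le _ _)
    (fun a x => by
      rw [Real.norm_eq_abs, Real.mul_iSup_of_nonneg (abs_nonneg a)]
      congr 1
      ext i
      simp only [f]
      rw [map_smul, norm_smul, Real.norm_eq_abs]
      ring)
  have hv : ∀ x, v x = ⨆ i, f i x := fun x => rfl
  refine ⟨v, max C 1, by positivity, fun x => ?_, fun x => ?_, fun A hA x => ?_⟩
  · have := le_ciSup (hbdd x) ⟨⟨fun _ => A₀, fun _ => hA₀⟩, 0⟩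
    simpa [hv, f, transition, toEuclideanLin_one_apply] using this
  · rw [hv]
    refine ciSup_le fun i => (hf i x).trans ?_
    gcongr
    exact le_max_left _ _
  · rw [hv, hv]
    refine ciSup_le fun i => ?_
    -- Applying `A` first prepends it to the sequence; the product is one longer, which accounts for
    -- the factor `c`.
    let A' : ℕ → Matrix (Fin n) (Fin n) ℝ := fun k => Nat.casesOn k A i.1.1
    have hA' : ∀ k, A' k ∈ D := fun k => by
      cases k with
      | zero => exact hA
      | succ k => exact i.1.2 k
    have ht : transition A' (i.2 + 1) = transition i.1.1 i.2 * A := by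
      rw [add_comm, transition_add]
      have h1 : (fun j => A' (1 + j)) = i.1.1 := by
        ext1 j
        rw [add_comm]
      rw [h1]
      simp [transition, A']
    have := le_ciSup (hbdd x) ⟨⟨A', hA'⟩, i.2 + 1⟩
    simp only [f] at this ⊢
    rw [ht, toEuclideanLin_mul_apply] at this
    refine le_trans (le_of_eq ?_) (mul_le_mul_of_nonneg_left this hc.le)
    rw [pow_succ, mul_inv]
    field_simp

/-! ### Matrices whose powers decay -/

/-- The powers of `B` decay at the rate `β`. -/
def PowersDecay (β : ℝ) (B : Matrix (Fin n) (Fin n) ℝ) : Prop :=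
  ∃ C : ℝ, ∀ m : ℕ, ‖B ^ m‖ ≤ C * β ^ m

theorem PowersDecay.smul {β : ℝ} {B : Matrix (Fin n) (Fin n) ℝ} (h : PowersDecay β B) {c : ℝ}
    (hc0 : 0 ≤ c) (hc1 : c ≤ 1) : PowersDecay β (c • B) := by
  obtain ⟨C, h⟩ := h
  refine ⟨C, fun m => le_trans ?_ (h m)⟩
  rw [smul_pow, norm_smul, Real.norm_of_nonneg (by positivity)]
  exact mul_le_of_le_one_left (norm_nonneg _) (pow_le_one₀ hc0 hc1)

/-- For an eigenvalue `z`, `z ^ m` is an eigenvalue of `B ^ m`, so `‖z‖ ^ m` is at most a constant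
times `β ^ m` for all `m`. -/
theorem PowersDecay.norm_root_le {β : ℝ} (hβ : 0 < β) {B : Matrix (Fin n) (Fin n) ℝ}
    (h : PowersDecay β B) {z : ℂ} (hz : z ∈ (B.charpoly.map Complex.ofRealHom).roots) :
    ‖z‖ ≤ β := by
  obtain ⟨C, h⟩ := h
  let φ : Matrix (Fin n) (Fin n) ℝ →ₗ[ℝ] Matrix (Fin n) (Fin n) ℂ :=
    { toFun := fun A => A.map Complex.ofRealHom
      map_add' := fun A B => by ext; simp
      map_smul' := fun c A => by ext; simp }
  let φ' := LinearMap.toContinuousLinearMap φ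
  have hφ : ∀ A, φ' A = A.map Complex.ofRealHom := fun A => rfl
  have hzs : z ∈ spectrum ℂ (B.map Complex.ofRealHom) := by
    rw [Matrix.mem_spectrum_iff_isRoot_charpoly, Matrix.charpoly_map]
    exact Polynomial.isRoot_of_mem_roots hz
  set K : ℝ := ‖φ'‖ * C * ‖(1 : Matrix (Fin n) (Fin n) ℂ)‖
  have hbound : ∀ m : ℕ, ‖z‖ ^ m ≤ K * β ^ m := fun m => by
    have h1 := spectrum.norm_le_norm_mul_of_mem (spectrum.pow_mem_pow _ m hzs)
    have h2 : (B.map Complex.ofRealHom) ^ m = φ' (B ^ m) := by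
      rw [hφ]
      exact (map_pow Complex.ofRealHom.mapMatrix B m).symm
    rw [h2, norm_pow] at h1
    refine h1.trans ?_
    calc ‖φ' (B ^ m)‖ * ‖(1 : Matrix (Fin n) (Fin n) ℂ)‖
        ≤ (‖φ'‖ * (C * β ^ m)) * ‖(1 : Matrix (Fin n) (Fin n) ℂ)‖ := by
          gcongr
          exact (φ'.le_opNorm _).trans (mul_le_mul_of_nonneg_left (h m) (norm_nonneg _))
      _ = K * β ^ m := by ring
  by_contra! hlt
  obtain ⟨m, hm⟩ := pow_unbounded_of_one_lt K ((one_lt_div hβ).2 hlt)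
  rw [div_pow, lt_div_iff₀ (by positivity)] at hm
  exact absurd (hbound m) (not_le.2 hm)

/-- If a seminorm does not increase under `B` and the powers of `B` decay at the rate `β`, then
vectors are moved by `B` by a fixed proportion of their seminorm. -/
theorem PowersDecay.seminorm_le {β : ℝ} (hβ0 : 0 < β) (hβ1 : β < 1)
    {B : Matrix (Fin n) (Fin n) ℝ} (h : PowersDecay β B)
    (v : Seminorm ℝ (EuclideanSpace ℝ (Fin n))) (hv : ∀ x, v (B.toEuclideanLin x) ≤ v x)
    (x : EuclideanSpace ℝ (Fin n)) :
    (1 - β) ^ n * v x ≤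
      ((n + 1) * (n.choose (n / 2) * n) : ℝ) * v (B.toEuclideanLin x - x) := by
  set q := B.charpoly
  set qc := q.map Complex.ofRealHom with hqc
  have hmon : q.Monic := B.charpoly_monic
  have hmonc : qc.Monic := hmon.map _
  have hdeg : q.natDegree = n := B.charpoly_natDegree_eq_dim.trans (Fintype.card_fin n)
  have hdegc : qc.natDegree = n := by rw [hqc, hmon.natDegree_map, hdeg]
  have hsplit : qc.Splits := IsAlgClosed.splits _
  have hroots : ∀ z ∈ qc.roots, ‖z‖ ≤ β := fun z hz => h.norm_root_le hβ0 hz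
  have hcard : Multiset.card qc.roots = n := by rw [← hsplit.natDegree_eq_card_roots, hdegc]
  have hcoeff : ∀ i, |q.coeff i| ≤ n.choose (n / 2) := fun i => by
    have := Polynomial.coeff_bdd_of_roots_le Complex.ofRealHom hmon hsplit hdeg.le hroots i
    rw [max_eq_right hβ1.le, one_pow, one_mul, Polynomial.coeff_map] at this
    simpa using this
  -- `q.eval 1` is the product of the factors `1 - z` over the complex roots, each of modulus at
  -- least `1 - β`.
  have hval : (1 - β) ^ n ≤ |q.eval 1| := by
    have h1 : ((q.eval 1 : ℝ) : ℂ) = qc.eval 1 := by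
      rw [hqc, Polynomial.eval_map, ← map_one Complex.ofRealHom, Polynomial.eval₂_hom]
      rfl
    have h2 : |q.eval 1| = ‖qc.eval 1‖ := by rw [← h1, Complex.norm_real, Real.norm_eq_abs]
    rw [h2, hsplit.eval_eq_prod_roots_of_monic hmonc, ← hcard]
    have key : ∀ s : Multiset ℂ, (∀ z ∈ s, ‖z‖ ≤ β) →
        (1 - β) ^ (Multiset.card s) ≤ ‖(s.map fun z => 1 - z).prod‖ := by
      intro s
      induction s using Multiset.induction_on with
      | empty => simp
      | cons a s ih =>
        intro hs
        rw [Multiset.card_cons, Multiset.map_cons, Multiset.prod_cons, norm_mul, pow_succ']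
        have ha : 1 - β ≤ ‖1 - a‖ := by
          have h3 := norm_sub_norm_le (1 : ℂ) a
          have h4 := hs a (Multiset.mem_cons_self _ _)
          rw [norm_one] at h3
          linarith
        exact mul_le_mul ha (ih fun z hz => hs z (Multiset.mem_cons_of_mem hz))
          (by have := sub_pos.2 hβ1; positivity) (norm_nonneg _)
    exact key _ hroots
  have hpow : ∀ i : ℕ, v ((B ^ i).toEuclideanLin x - x) ≤ i * v (B.toEuclideanLin x - x) := by
    have hcontr : ∀ (i : ℕ) y, v ((B ^ i).toEuclideanLin y) ≤ v y := fun i => by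
      induction i with
      | zero => simp
      | succ i ih =>
        intro y
        rw [pow_succ, toEuclideanLin_mul_apply]
        exact (ih _).trans (hv y)
    intro i
    induction i with
    | zero => simp
    | succ i ih =>
      have h1 : (B ^ (i + 1)).toEuclideanLin x - x =
          (B ^ i).toEuclideanLin (B.toEuclideanLin x - x) + ((B ^ i).toEuclideanLin x - x) := by
        rw [pow_succ, toEuclideanLin_mul_apply, map_sub]
        abel
      rw [h1]
      refine (map_add_le_add v _ _).trans ((add_le_add (hcontr i _) ih).trans (le_of_eq ?_))
      push_cast
      ring
  -- Cayley–Hamilton: `q(B) x = 0`, from which `q(1) x` is subtracted.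
  have hsum : ∑ i ∈ Finset.range (n + 1), q.coeff i • ((B ^ i).toEuclideanLin x - x) =
      -(q.eval 1) • x := by
    have h1 : (∑ i ∈ Finset.range (n + 1), q.coeff i • (B ^ i)).toEuclideanLin x = 0 := by
      have := B.aeval_self_charpoly
      rw [Polynomial.aeval_eq_sum_range, show B.charpoly.natDegree = n from hdeg] at this
      rw [this]
      simp
    rw [Polynomial.eval_eq_sum_range, hdeg]
    simp only [smul_sub, Finset.sum_sub_distrib, one_pow, mul_one, neg_smul, Finset.sum_smul]
    simp only [map_sum, map_smul, LinearMap.sum_apply, LinearMap.smul_apply] at h1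
    rw [h1, zero_sub]
  calc (1 - β) ^ n * v x ≤ |q.eval 1| * v x := by gcongr
    _ = v (-(q.eval 1) • x) := by rw [map_smul_eq_mul, norm_neg, Real.norm_eq_abs]
    _ = v (∑ i ∈ Finset.range (n + 1), q.coeff i • ((B ^ i).toEuclideanLin x - x)) := by rw [hsum]
    _ ≤ ∑ i ∈ Finset.range (n + 1), v (q.coeff i • ((B ^ i).toEuclideanLin x - x)) :=
        Finset.le_sum_of_subadditive v (map_zero v).le (map_add_le_add v) _ _
    _ ≤ ∑ i ∈ Finset.range (n + 1), (n.choose (n / 2) * n : ℝ) * v (B.toEuclideanLin x - x) := by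
        refine Finset.sum_le_sum fun i hi => ?_
        rw [map_smul_eq_mul, Real.norm_eq_abs, mul_assoc]
        have hin : (i : ℝ) ≤ n := by exact_mod_cast Finset.mem_range_succ_iff.1 hi
        have h0 : 0 ≤ v (B.toEuclideanLin x - x) := apply_nonneg _ _
        exact mul_le_mul (hcoeff i) ((hpow i).trans (by gcongr)) (apply_nonneg _ _) (by positivity)
    _ = _ := by
        rw [Finset.sum_const, Finset.card_range, nsmul_eq_mul]
        push_cast
        ring

/-! ### Contraction of long products -/

theorem continuous_seminorm_of_le {v : Seminorm ℝ (EuclideanSpace ℝ (Fin n))} {C : ℝ}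
    (hC : 0 < C) (hv : ∀ x, v x ≤ C * ‖x‖) : Continuous v := by
  refine (LipschitzWith.of_dist_le_mul (K := C.toNNReal) fun x y => ?_).continuous
  rw [Real.coe_toNNReal C hC.le, dist_eq_norm, dist_eq_norm]
  exact (abs_sub_map_le_sub v x y).trans (hv _)

open scoped Pointwise in
/-- A bound, independent of the norm, for the number of separated points in the unit ball of a
norm. -/
theorem card_mul_pow_le_of_separated {v : Seminorm ℝ (EuclideanSpace ℝ (Fin n))} {C : ℝ}
    (hC : 0 < C) (hv1 : ∀ x, ‖x‖ ≤ v x) (hv2 : ∀ x, v x ≤ C * ‖x‖) {δ : ℝ} (hδ : 0 < δ)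
    {ι : Type*} (s : Finset ι) (x : ι → EuclideanSpace ℝ (Fin n)) (hs : ∀ i ∈ s, v (x i) ≤ 1)
    (h : ∀ i ∈ s, ∀ j ∈ s, i ≠ j → 2 * δ ≤ v (x i - x j)) :
    (s.card : ℝ) * δ ^ n ≤ (1 + δ) ^ n := by
  have hcont := continuous_seminorm_of_le hC hv2
  have hball : ∀ (y : EuclideanSpace ℝ (Fin n)) (r : ℝ), 0 < r →
      volume (v.ball y r) = ENNReal.ofReal (r ^ n) * volume (v.ball 0 1) := fun y r hr => by
    have h1 : v.ball y r = y +ᵥ r • v.ball 0 1 := by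
      rw [Seminorm.smul_ball_zero hr.ne', Seminorm.vadd_ball]
      simp [abs_of_pos hr]
    rw [h1, measure_vadd, Measure.addHaar_smul, finrank_euclideanSpace_fin,
      abs_of_pos (by positivity)]
  have hmeas : ∀ y r, MeasurableSet (v.ball y r) := fun y r => by
    have : IsOpen (v.ball y r) :=
      isOpen_lt (hcont.comp (continuous_id.sub continuous_const)) continuous_const
    exact this.measurableSet
  have hpos : volume (v.ball 0 1) ≠ 0 := by
    have ho : IsOpen (v.ball 0 1) :=
      isOpen_lt (hcont.comp (continuous_id.sub continuous_const)) continuous_const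
    exact (ho.measure_pos volume ⟨0, by simp⟩).ne'
  have hfin : volume (v.ball 0 1) ≠ ⊤ := by
    refine ne_top_of_le_ne_top
      (measure_ball_lt_top (x := (0 : EuclideanSpace ℝ (Fin n))) (r := 1)).ne
      (measure_mono fun y hy => ?_)
    rw [Seminorm.mem_ball_zero] at hy
    rw [mem_ball_zero_iff]
    exact (hv1 y).trans_lt hy
  have hdisj : (s : Set ι).PairwiseDisjoint fun i => v.ball (x i) δ := by
    intro i hi j hj hij
    refine Set.disjoint_left.2 fun y hyi hyj => ?_
    rw [Seminorm.mem_ball] at hyi hyj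
    have h1 := h i hi j hj hij
    have h2 : x i - x j = (y - x j) - (y - x i) := by abel
    rw [h2] at h1
    have h3 := map_sub_le_add v (y - x j) (y - x i)
    linarith
  have hsub : (⋃ i ∈ s, v.ball (x i) δ) ⊆ v.ball 0 (1 + δ) := by
    refine Set.iUnion₂_subset fun i hi y hy => ?_
    rw [Seminorm.mem_ball] at hy
    rw [Seminorm.mem_ball_zero]
    have h1 := map_add_le_add v (x i) (y - x i)
    rw [add_sub_cancel] at h1
    linarith [hs i hi]
  -- Disjoint balls of radius `δ` lie in the ball of radius `1 + δ`. All volumes are multiples of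
  -- that of the unit ball, which cancels; hence no dependence on the norm.
  have hle : (s.card : ENNReal) * ENNReal.ofReal (δ ^ n) * volume (v.ball 0 1) ≤
      ENNReal.ofReal ((1 + δ) ^ n) * volume (v.ball 0 1) := by
    rw [← hball 0 (1 + δ) (by positivity)]
    refine le_trans (le_of_eq ?_) (measure_mono hsub)
    rw [measure_biUnion_finset hdisj fun i _ => hmeas _ _]
    simp only [hball _ δ hδ, Finset.sum_const, nsmul_eq_mul, mul_assoc]
  have hle' := (ENNReal.mul_le_mul_iff_left hpos hfin).1 hle
  have := ENNReal.toReal_le_of_le_ofReal (by positivity) hle'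
  rwa [ENNReal.toReal_mul, ENNReal.toReal_natCast, ENNReal.toReal_ofReal (by positivity)] at this

/-- Products of a fixed number of matrices are contractions by the factor `1 / 2`, if the matrices
do not increase a norm and the powers of each partial product decay at the rate `β`.  The number
does not depend on the norm. -/
theorem exists_transition_contracts (n : ℕ) {β : ℝ} (hβ0 : 0 < β) (hβ1 : β < 1) :
    ∃ N : ℕ, 0 < N ∧ ∀ (v : Seminorm ℝ (EuclideanSpace ℝ (Fin n))) (C : ℝ), 0 < C →
      (∀ x, ‖x‖ ≤ v x) → (∀ x, v x ≤ C * ‖x‖) →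
      ∀ A : ℕ → Matrix (Fin n) (Fin n) ℝ, (∀ i x, v ((A i).toEuclideanLin x) ≤ v x) →
        (∀ i k, 0 < k → PowersDecay β (transition (fun j => A (i + j)) k)) →
        ∀ x, v ((transition A N).toEuclideanLin x) ≤ 1 / 2 * v x := by
  set K : ℝ := (n + 1) * (n.choose (n / 2) * n) with hK
  have hK0 : 0 ≤ K := by positivity
  have hβ' : 0 < 1 - β := sub_pos.2 hβ1
  -- Chosen so that `seminorm_le`, applied to an orbit point with `v > 1 / 2`, forces displacements
  -- of at least `2 * δ`. The `+ 1` avoids division by zero when `n = 0`.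
  set δ : ℝ := (1 - β) ^ n / (4 * (K + 1)) with hδdef
  have hδ : 0 < δ := by positivity
  obtain ⟨N, hN⟩ := exists_nat_gt ((1 + δ) ^ n / δ ^ n)
  rw [div_lt_iff₀ (by positivity)] at hN
  have hN0 : 0 < N := by
    rcases Nat.eq_zero_or_pos N with rfl | h
    · have : 0 < (1 + δ) ^ n := by positivity
      simp only [Nat.cast_zero, zero_mul] at hN
      linarith
    · exact h
  refine ⟨N, hN0, fun v C hC hv1 hv2 A hA hdec => ?_⟩
  have hcontr : ∀ (A : ℕ → Matrix (Fin n) (Fin n) ℝ),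
      (∀ i x, v ((A i).toEuclideanLin x) ≤ v x) →
      ∀ k x, v ((transition A k).toEuclideanLin x) ≤ v x := fun A hA k x => by
    induction k with
    | zero => rw [transition, toEuclideanLin_one_apply]
    | succ k ih =>
      rw [transition, toEuclideanLin_mul_apply]
      exact (hA _ _).trans ih
  have hunit : ∀ x, v x ≤ 1 → v ((transition A N).toEuclideanLin x) ≤ 1 / 2 := fun x hx => by
    by_contra! hlt
    let y : ℕ → EuclideanSpace ℝ (Fin n) := fun i => (transition A i).toEuclideanLin x
    have hstep : ∀ i k, y (i + k) =
        (transition (fun j => A (i + j)) k).toEuclideanLin (y i) := fun i k => by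
      simp only [y]
      rw [transition_add, toEuclideanLin_mul_apply]
    have hylow : ∀ i, i ≤ N → 1 / 2 < v (y i) := fun i hi => by
      obtain ⟨k, rfl⟩ := Nat.exists_eq_add_of_le hi
      have h1 : v (y (i + k)) ≤ v (y i) := by
        rw [hstep]
        exact hcontr _ (fun j => hA _) k _
      exact hlt.trans_le h1
    have hsep : ∀ i k, 0 < k → i + k ≤ N → 2 * δ ≤ v (y (i + k) - y i) := fun i k hk hik => by
      have h1 := (hdec i k hk).seminorm_le hβ0 hβ1 v (hcontr _ (fun j => hA _) k) (y i)
      rw [← hstep] at h1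
      have h2 := hylow i (by omega)
      by_contra! h3
      have h4 : (1 - β) ^ n = δ * (4 * (K + 1)) := by
        rw [hδdef]
        field_simp
      have h5 : K * v (y (i + k) - y i) ≤ K * (2 * δ) := by gcongr
      have h6 : (1 - β) ^ n * (1 / 2) < (1 - β) ^ n * v (y i) := by gcongr
      rw [h4] at h6 h1
      nlinarith
    have hcard := card_mul_pow_le_of_separated hC hv1 hv2 hδ (Finset.range N) y
      (fun i _ => (hcontr A hA i x).trans hx) (fun i hi j hj hij => by
        rw [Finset.mem_range] at hi hj
        rcases lt_or_gt_of_ne hij with h | h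
        · obtain ⟨k, rfl⟩ := Nat.exists_eq_add_of_lt h
          rw [map_sub_rev]
          exact hsep i (k + 1) (by omega) (by omega)
        · obtain ⟨k, rfl⟩ := Nat.exists_eq_add_of_lt h
          exact hsep j (k + 1) (by omega) (by omega))
    rw [Finset.card_range] at hcard
    linarith
  intro x
  have hx0 : 0 ≤ v x := apply_nonneg v x
  rcases hx0.eq_or_lt with h0 | h0
  · have := hcontr A hA N x
    linarith
  · have h1 := hunit ((v x)⁻¹ • x) (by
      rw [map_smul_eq_mul, norm_inv, Real.norm_of_nonneg hx0, inv_mul_cancel₀ h0.ne'])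
    rw [map_smul, map_smul_eq_mul, norm_inv, Real.norm_of_nonneg hx0, inv_mul_le_iff₀ h0] at h1
    linarith

/-- The number by which the growth bound can be improved depends on `β` and on the dimension
only. -/
theorem exists_growthBound_div (n : ℕ) {β : ℝ} (hβ0 : 0 < β) (hβ1 : β < 1) :
    ∃ θ : ℝ, 1 < θ ∧ ∀ D : Set (Matrix (Fin n) (Fin n) ℝ), D.Nonempty →
      (∀ A : ℕ → Matrix (Fin n) (Fin n) ℝ, (∀ i, A i ∈ D) →
        ∀ k, 0 < k → PowersDecay β (transition A k)) →
      ∀ c : ℝ, 1 ≤ c → GrowthBound D c → GrowthBound D (c / θ) := by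
  obtain ⟨N, hN0, hN⟩ := exists_transition_contracts n hβ0 hβ1
  -- Halving in `N` steps amounts to dividing the rate by the `N`-th root of `2`.
  obtain ⟨θ, hθ0, hθN⟩ : ∃ θ : ℝ, 0 < θ ∧ θ ^ N = 2 :=
    ⟨2 ^ ((N : ℝ)⁻¹), by positivity, Real.rpow_inv_natCast_pow (by norm_num) hN0.ne'⟩
  have hθ1 : 1 < θ := by
    by_contra! h
    have := pow_le_one₀ hθ0.le h (n := N)
    linarith
  refine ⟨θ, hθ1, fun D hD hdec c hc hgrow => ?_⟩
  have hc0 : 0 < c := by linarith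
  obtain ⟨v, C, hC, hv1, hv2, hv3⟩ := hgrow.exists_seminorm hD hc0
  refine ⟨2 * C, fun A hA k x => ?_⟩
  have hscaled : ∀ A : ℕ → Matrix (Fin n) (Fin n) ℝ, (∀ i, A i ∈ D) → ∀ x,
      v ((transition A N).toEuclideanLin x) ≤ c ^ N / 2 * v x := fun A hA x => by
    have h1 := hN v C hC hv1 hv2 (fun i => c⁻¹ • A i)
      (fun i x => by
        rw [map_smul, LinearMap.smul_apply, map_smul_eq_mul, norm_inv,
          Real.norm_of_nonneg hc0.le, inv_mul_le_iff₀ hc0]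
        exact hv3 _ (hA i) x)
      -- Here `1 ≤ c` is needed: rescaling by `c⁻¹` must not spoil the decay of powers.
      (fun i k hk => by
        rw [transition_smul c⁻¹ (fun j => A (i + j))]
        exact (hdec _ (fun j => hA _) k hk).smul (by positivity)
          (pow_le_one₀ (by positivity) (inv_le_one_of_one_le₀ hc))) x
    rw [transition_smul, map_smul, LinearMap.smul_apply, map_smul_eq_mul, norm_pow, norm_inv,
      Real.norm_of_nonneg hc0.le, inv_pow, inv_mul_le_iff₀ (by positivity)] at h1
    linarith
  have hrem : ∀ A : ℕ → Matrix (Fin n) (Fin n) ℝ, (∀ i, A i ∈ D) → ∀ r x,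
      v ((transition A r).toEuclideanLin x) ≤ c ^ r * v x := fun A hA r x => by
    induction r with
    | zero => simp [transition]
    | succ r ih =>
      rw [transition, toEuclideanLin_mul_apply, pow_succ', mul_assoc]
      exact (hv3 _ (hA r) _).trans (by gcongr)
  have hmul : ∀ q : ℕ, ∀ A : ℕ → Matrix (Fin n) (Fin n) ℝ, (∀ i, A i ∈ D) → ∀ x,
      v ((transition A (N * q)).toEuclideanLin x) ≤ (c ^ N / 2) ^ q * v x := fun q => by
    induction q with
    | zero => intro A hA x; simp [transition]
    | succ q ih =>
      intro A hA x
      rw [Nat.mul_succ, transition_add, toEuclideanLin_mul_apply, pow_succ', mul_assoc]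
      exact (hscaled _ (fun j => hA _) _).trans (by gcongr; exact ih A hA x)
  have hk : k = N * (k / N) + k % N := (Nat.div_add_mod k N).symm
  set q := k / N
  set r := k % N
  have hr : r < N := Nat.mod_lt k hN0
  -- The extra factor `2` pays for the incomplete last block of length `r < N`.
  have hθk : θ ^ k ≤ 2 * 2 ^ q := by
    rw [hk, pow_add, pow_mul, hθN, mul_comm]
    have : θ ^ r ≤ 2 := hθN ▸ pow_le_pow_right₀ hθ1.le hr.le
    gcongr
  calc ‖(transition A k).toEuclideanLin x‖ ≤ v ((transition A k).toEuclideanLin x) := hv1 _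
    _ ≤ c ^ r * ((c ^ N / 2) ^ q * v x) := by
        rw [hk, transition_add, toEuclideanLin_mul_apply]
        exact (hrem _ (fun j => hA _) r _).trans (by gcongr; exact hmul q A hA x)
    _ = c ^ k / 2 ^ q * v x := by
        rw [div_pow, ← pow_mul, hk, pow_add]
        ring
    _ ≤ 2 * (c / θ) ^ k * (C * ‖x‖) := by
        have h1 : c ^ k / 2 ^ q ≤ 2 * (c / θ) ^ k := by
          rw [div_pow, mul_div_assoc', div_le_div_iff₀ (by positivity) (by positivity)]
          nlinarith [pow_pos hc0 k]
        have := hv2 x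
        gcongr
    _ = 2 * C * (c / θ) ^ k * ‖x‖ := by ring

/-- If the powers of all products of matrices from a bounded set decay at a common rate, then the
set is absolutely exponentially stable. -/
theorem exists_growthBound_lt_one {D : Set (Matrix (Fin n) (Fin n) ℝ)}
    (hbdd : Bornology.IsBounded D) {β : ℝ} (hβ0 : 0 < β) (hβ1 : β < 1)
    (hdec : ∀ A : ℕ → Matrix (Fin n) (Fin n) ℝ, (∀ i, A i ∈ D) →
      ∀ k, 0 < k → PowersDecay β (transition A k)) :
    ∃ c : ℝ, 0 < c ∧ c < 1 ∧ GrowthBound D c := by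
  rcases D.eq_empty_or_nonempty with rfl | hD
  · exact ⟨1 / 2, by norm_num, by norm_num, 0, fun A hA => (hA 0).elim⟩
  obtain ⟨θ, hθ, hstep⟩ := exists_growthBound_div n hβ0 hβ1
  obtain ⟨L, hL⟩ := hbdd.exists_norm_le
  set c₀ : ℝ := max L 1
  have hc₀ : 0 < c₀ := by positivity
  have h0 : GrowthBound D c₀ := ⟨1, fun A hA k x => by
    rw [one_mul]
    exact norm_transition_apply_le hc₀.le (fun k => (hL _ (hA k)).trans (le_max_left _ _)) k x⟩
  -- If no rate below one is admissible, every rate reached is at least one, so the improvement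
  -- never stops.
  by_contra! hcon
  have hiter : ∀ m : ℕ, GrowthBound D (c₀ / θ ^ m) := fun m => by
    induction m with
    | zero => simpa using h0
    | succ m ih =>
      rw [pow_succ, ← div_div]
      refine hstep D hD hdec _ ?_ ih
      by_contra! hlt
      exact hcon _ (by positivity) hlt ih
  obtain ⟨m, hm⟩ := pow_unbounded_of_one_lt c₀ hθ
  exact hcon _ (by positivity) ((div_lt_one (by positivity)).2 hm) (hiter m)

/-! ### From absolute exponential stability to Lyapunov functions -/

theorem measure_compl_support_eq_zero (μ : Measure (Matrix (Fin n) (Fin n) ℝ)) :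
    μ μ.supportᶜ = 0 := by
  have : SecondCountableTopology (Matrix (Fin n) (Fin n) ℝ) :=
    inferInstanceAs (SecondCountableTopology (Fin n → Fin n → ℝ))
  exact Measure.measure_compl_support

theorem support_nonempty (μ : Measure (Matrix (Fin n) (Fin n) ℝ)) [IsProbabilityMeasure μ] :
    μ.support.Nonempty := by
  by_contra h
  have h1 := measure_compl_support_eq_zero μ
  rw [Set.not_nonempty_iff_eq_empty.1 h, Set.compl_empty, measure_univ] at h1
  exact one_ne_zero h1

theorem GrowthBound.exists_isStochasticLyapunov {μ : Measure (Matrix (Fin n) (Fin n) ℝ)}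
    [IsProbabilityMeasure μ] {c : ℝ} (hc0 : 0 < c) (hc1 : c < 1) (h : GrowthBound μ.support c)
    (p : ℕ) : ∃ V, IsStochasticLyapunov μ p c V := by
  obtain ⟨v, C, hC, hv1, hv2, hv3⟩ := h.exists_seminorm (support_nonempty μ) hc0
  have hcont := continuous_seminorm_of_le hC hv2
  have hle : ∀ x, ∀ᵐ A ∂μ, v (A.toEuclideanLin x) ^ p ≤ c ^ p * v x ^ p := fun x => by
    have hae : ∀ᵐ A ∂μ, A ∈ μ.support := measure_compl_support_eq_zero μ
    filter_upwards [hae] with A hA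
    rw [← mul_pow]
    exact pow_le_pow_left₀ (apply_nonneg v _) (hv3 A hA x) p
  have hint : ∀ x, Integrable (fun A => v (A.toEuclideanLin x) ^ p) μ := fun x => by
    have hc : Continuous fun A : Matrix (Fin n) (Fin n) ℝ => v (A.toEuclideanLin x) ^ p :=
      (hcont.comp (continuous_toEuclideanLin_apply x)).pow p
    refine Integrable.of_bound hc.measurable.aestronglyMeasurable (c ^ p * v x ^ p) ?_
    filter_upwards [hle x] with A hA
    rwa [Real.norm_of_nonneg (pow_nonneg (apply_nonneg v _) p)]
  refine ⟨fun x => v x ^ p, hc0.le, hc1, ⟨1, C ^ p, one_pos, by positivity, fun x => ⟨?_, ?_⟩⟩,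
    hint, fun x => ?_⟩
  · rw [one_mul]
    exact pow_le_pow_left₀ (norm_nonneg x) (hv1 x) p
  · rw [← mul_pow]
    exact pow_le_pow_left₀ (apply_nonneg v x) (hv2 x) p
  · refine (integral_mono_ae (hint x) (integrable_const _) (hle x)).trans (le_of_eq ?_)
    simp

/-! ### Proper cones -/

theorem IsProperCone.zero_mem {K : Set (EuclideanSpace ℝ (Fin n))} (hK : IsProperCone K) :
    (0 : EuclideanSpace ℝ (Fin n)) ∈ K := by
  obtain ⟨x, hx⟩ := hK.solid
  simpa using hK.smul_mem 0 le_rfl x (interior_subset hx)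

theorem IsProperCone.add_mem {K : Set (EuclideanSpace ℝ (Fin n))} (hK : IsProperCone K)
    {x y : EuclideanSpace ℝ (Fin n)} (hx : x ∈ K) (hy : y ∈ K) : x + y ∈ K := by
  have h := hK.smul_mem 2 (by norm_num) _
    (hK.convex hx hy (a := 1 / 2) (b := 1 / 2) (by norm_num) (by norm_num) (by norm_num))
  rwa [smul_add, smul_smul, smul_smul, mul_one_div_cancel two_ne_zero, one_smul, one_smul] at h

/-- Proper cones are normal. -/
theorem IsProperCone.exists_mul_norm_le {K : Set (EuclideanSpace ℝ (Fin n))}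
    (hK : IsProperCone K) :
    ∃ κ : ℝ, 0 < κ ∧ ∀ x ∈ K, ∀ y, y - x ∈ K → κ * ‖x‖ ≤ ‖y‖ := by
  obtain ⟨κ, hκ, hmin⟩ : ∃ κ : ℝ, 0 < κ ∧ ∀ x ∈ K, ‖x‖ = 1 → ∀ w ∈ K, ‖w‖ ≤ 2 → κ ≤ ‖x + w‖ := by
    -- On this compact set `‖x + w‖` attains its minimum, which is positive because the cone is
    -- pointed.
    set S : Set (EuclideanSpace ℝ (Fin n) × EuclideanSpace ℝ (Fin n)) :=
      (Metric.sphere 0 1 ∩ K) ×ˢ (Metric.closedBall 0 2 ∩ K)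
    have hS : IsCompact S := ((isCompact_sphere _ _).inter_right hK.isClosed).prod
      ((isCompact_closedBall _ _).inter_right hK.isClosed)
    rcases S.eq_empty_or_nonempty with hemp | hne
    · refine ⟨1, one_pos, fun x hx hx1 w hw hw2 => ?_⟩
      have : (x, w) ∈ S := ⟨⟨by simpa using hx1, hx⟩, ⟨by simpa using hw2, hw⟩⟩
      rw [hemp] at this
      exact this.elim
    · obtain ⟨⟨x₀, w₀⟩, hmem, hmin⟩ := hS.exists_isMinOn hne
        (f := fun q => ‖q.1 + q.2‖) (by fun_prop)
      rw [isMinOn_iff] at hmin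
      refine ⟨‖x₀ + w₀‖, ?_, fun x hx hx1 w hw hw2 => ?_⟩
      swap
      · exact hmin (x, w) ⟨⟨by simpa using hx1, hx⟩, ⟨by simpa using hw2, hw⟩⟩
      rw [norm_pos_iff]
      intro h0
      have h1 : x₀ = 0 := by
        refine hK.pointed _ hmem.1.2 ?_
        rw [neg_eq_of_add_eq_zero_right h0]
        exact hmem.2.2
      have h2 := hmem.1.1
      simp [h1] at h2
  refine ⟨min κ 1, by positivity, fun x hx y hy => ?_⟩
  rcases (norm_nonneg x).eq_or_lt with h0 | h0
  · rw [← h0, mul_zero]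
    exact norm_nonneg y
  have hx' := hK.smul_mem ‖x‖⁻¹ (by positivity) x hx
  have hw' := hK.smul_mem ‖x‖⁻¹ (by positivity) _ hy
  have hx1 : ‖‖x‖⁻¹ • x‖ = 1 := by
    rw [norm_smul, norm_inv, norm_norm, inv_mul_cancel₀ h0.ne']
  have hsum : ‖x‖⁻¹ • x + ‖x‖⁻¹ • (y - x) = ‖x‖⁻¹ • y := by
    rw [← smul_add, add_sub_cancel]
  have hy1 : ‖‖x‖⁻¹ • y‖ = ‖y‖ / ‖x‖ := by
    rw [norm_smul, norm_inv, norm_norm, inv_mul_eq_div]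
  rw [← le_div_iff₀ h0, ← hy1]
  -- Outside the compact range, the triangle inequality gives a norm of at least `2 - 1 = 1`.
  by_cases hw2 : ‖‖x‖⁻¹ • (y - x)‖ ≤ 2
  · rw [← hsum]
    exact (min_le_left _ _).trans (hmin _ hx' hx1 _ hw' hw2)
  · have h3 : ‖x‖⁻¹ • (y - x) = ‖x‖⁻¹ • y - ‖x‖⁻¹ • x := smul_sub _ _ _
    rw [h3] at hw2
    have h4 := norm_sub_le (‖x‖⁻¹ • y) (‖x‖⁻¹ • x)
    have := min_le_right κ 1
    linarith

/-- Linear maps are controlled by their values on a proper cone. -/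
theorem IsProperCone.exists_norm_le {K : Set (EuclideanSpace ℝ (Fin n))} (hK : IsProperCone K) :
    ∃ c : ℝ, 0 ≤ c ∧
      ∀ (f : EuclideanSpace ℝ (Fin n) →ₗ[ℝ] EuclideanSpace ℝ (Fin n)) (b : ℝ), 0 ≤ b →
        (∀ x ∈ K, ‖f x‖ ≤ b * ‖x‖) → ∀ x, ‖f x‖ ≤ c * b * ‖x‖ := by
  obtain ⟨e, he⟩ := hK.solid
  obtain ⟨r, hr, hball⟩ := Metric.nhds_basis_closedBall.mem_iff.1 (mem_interior_iff_mem_nhds.1 he)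
  refine ⟨(2 * ‖e‖ + r) / r, by positivity, fun f b hb hf x => ?_⟩
  rcases (norm_nonneg x).eq_or_lt with h0 | h0
  · rw [norm_eq_zero.1 h0.symm]
    simp
  -- Rescaled to length `r`, `x` is a difference of the two cone elements `e + z` and `e`.
  set z := (r / ‖x‖) • x
  have hz : ‖z‖ = r := by
    rw [norm_smul, norm_div, norm_norm, Real.norm_of_nonneg hr.le, div_mul_cancel₀ _ h0.ne']
  have hez : e + z ∈ K := hball (by simp [hz])
  have h1 := hf _ hez
  have h2 := hf e (interior_subset he)
  have h3 : f z = f (e + z) - f e := by rw [map_add, add_sub_cancel_left]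
  have h4 : ‖f z‖ ≤ b * (2 * ‖e‖ + r) := by
    rw [h3]
    have h5 := norm_sub_le (f (e + z)) (f e)
    have h6 : b * ‖e + z‖ ≤ b * (‖e‖ + r) := by
      gcongr
      exact (norm_add_le _ _).trans_eq (by rw [hz])
    linarith
  rw [map_smul, norm_smul, norm_div, norm_norm, Real.norm_of_nonneg hr.le, div_mul_eq_mul_div,
    div_le_iff₀ h0] at h4
  rw [div_mul_eq_mul_div, div_mul_eq_mul_div, le_div_iff₀ hr]
  linarith

/-- The matrices that leave `K` invariant. -/
def coneMaps (K : Set (EuclideanSpace ℝ (Fin n))) : Set (Matrix (Fin n) (Fin n) ℝ) :=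
  {A | ∀ x ∈ K, A.toEuclideanLin x ∈ K}

theorem IsProperCone.smul_mem_coneMaps {K : Set (EuclideanSpace ℝ (Fin n))}
    (hK : IsProperCone K) {A : Matrix (Fin n) (Fin n) ℝ} (hA : A ∈ coneMaps K) {c : ℝ}
    (hc : 0 ≤ c) : c • A ∈ coneMaps K := fun x hx => by
  rw [map_smul, LinearMap.smul_apply]
  exact hK.smul_mem c hc _ (hA x hx)

theorem IsProperCone.add_mem_coneMaps {K : Set (EuclideanSpace ℝ (Fin n))}
    (hK : IsProperCone K) {A B : Matrix (Fin n) (Fin n) ℝ} (hA : A ∈ coneMaps K)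
    (hB : B ∈ coneMaps K) : A + B ∈ coneMaps K := fun x hx => by
  rw [map_add, LinearMap.add_apply]
  exact hK.add_mem (hA x hx) (hB x hx)

theorem IsProperCone.convex_coneMaps {K : Set (EuclideanSpace ℝ (Fin n))}
    (hK : IsProperCone K) : Convex ℝ (coneMaps K) := fun _ hA _ hB _ _ ha hb _ =>
  hK.add_mem_coneMaps (hK.smul_mem_coneMaps hA ha) (hK.smul_mem_coneMaps hB hb)

theorem transition_mem_coneMaps {K : Set (EuclideanSpace ℝ (Fin n))}
    {A : ℕ → Matrix (Fin n) (Fin n) ℝ} (hA : ∀ k, A k ∈ coneMaps K) (k : ℕ) :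
    transition A k ∈ coneMaps K := fun x hx => by
  induction k with
  | zero => rwa [transition, toEuclideanLin_one_apply]
  | succ k ih =>
    rw [transition, toEuclideanLin_mul_apply]
    exact hA k _ ih

theorem volume_frontier_eq_zero {s : Set (Matrix (Fin n) (Fin n) ℝ)} (hs : Convex ℝ s) :
    volume (frontier s) = 0 := by
  rw [matrix_volume_eq]
  exact Convex.addHaar_frontier (E := Fin n → Fin n → ℝ) volume hs

/-! ### Matrices that are almost dominated with positive probability -/

/-- The matrices in the support of `μ` all of whose multiples by a factor less than one are
dominated, in the order given by `K`, by a set of matrices of positive measure. -/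
def dominatedSupport (μ : Measure (Matrix (Fin n) (Fin n) ℝ))
    (K : Set (EuclideanSpace ℝ (Fin n))) : Set (Matrix (Fin n) (Fin n) ℝ) :=
  {A | A ∈ μ.support ∧ ∀ t : ℝ, t < 1 → 0 < μ {X | X - t • A ∈ coneMaps K}}

theorem mem_dominatedSupport_of_atom {μ : Measure (Matrix (Fin n) (Fin n) ℝ)}
    {K : Set (EuclideanSpace ℝ (Fin n))} (hK : IsProperCone K)
    (hinv : LeavesInvariant μ.support K) {A : Matrix (Fin n) (Fin n) ℝ} (hA : 0 < μ {A}) :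
    A ∈ dominatedSupport μ K := by
  have hsupp : A ∈ μ.support := by
    rw [Measure.mem_support_iff_forall]
    exact fun U hU => hA.trans_le (measure_mono (Set.singleton_subset_iff.2 (mem_of_mem_nhds hU)))
  refine ⟨hsupp, fun t ht => hA.trans_le (measure_mono (Set.singleton_subset_iff.2 ?_))⟩
  have h1 : A - t • A = (1 - t) • A := by rw [sub_smul, one_smul]
  rw [Set.mem_ofPred_eq, h1]
  exact hK.smul_mem_coneMaps (hinv A hsupp) (sub_nonneg.2 ht.le)

/-- `(1 - t)⁻¹ • (X - t • A)` equals `A` at `X = A`, so it stays in `coneMaps K` for `X` near `A`,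
and neighbourhoods of support points have positive measure. -/
theorem mem_dominatedSupport_of_mem_interior {μ : Measure (Matrix (Fin n) (Fin n) ℝ)}
    {K : Set (EuclideanSpace ℝ (Fin n))} (hK : IsProperCone K)
    {A : Matrix (Fin n) (Fin n) ℝ} (hA : A ∈ μ.support) (hint : A ∈ interior (coneMaps K)) :
    A ∈ dominatedSupport μ K := by
  refine ⟨hA, fun t ht => (Measure.mem_support_iff_forall A).1 hA _ ?_⟩
  have ht' : 0 < 1 - t := sub_pos.2 ht
  have hcont : Continuous fun X : Matrix (Fin n) (Fin n) ℝ => (1 - t)⁻¹ • (X - t • A) := by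
    fun_prop
  have hval : (1 - t)⁻¹ • (A - t • A) = A := by
    have h1 : A - t • A = (1 - t) • A := by rw [sub_smul, one_smul]
    rw [h1, inv_smul_smul₀ ht'.ne']
  have hnhds := hcont.continuousAt.preimage_mem_nhds (x := A)
    (by rw [hval]; exact mem_interior_iff_mem_nhds.1 hint)
  refine Filter.mem_of_superset hnhds fun X hX => ?_
  have := hK.smul_mem_coneMaps hX ht'.le
  rwa [smul_inv_smul₀ ht'.ne'] at this

/-- An open set that meets the support but misses `dominatedSupport` would be null: it contains no
atom `M i`, so the singular part vanishes on it, and its support points lie on the frontier of the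
convex set `coneMaps K`, which is Lebesgue null. -/
theorem support_subset_closure_dominatedSupport {μ : Measure (Matrix (Fin n) (Fin n) ℝ)}
    [IsProbabilityMeasure μ] {K : Set (EuclideanSpace ℝ (Fin n))} (hK : IsProperCone K)
    (hinv : LeavesInvariant μ.support K) (hsing : SingularPartFinitelyAtomic μ) :
    μ.support ⊆ closure (dominatedSupport μ K) := by
  obtain ⟨N, p, M, hp, hμs⟩ := hsing
  intro A hA
  rw [mem_closure_iff]
  intro U hU hAU
  by_contra hemp
  rw [Set.not_nonempty_iff_eq_empty] at hemp
  have hdec := Measure.singularPart_add_rnDeriv μ volume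
  have hpos : 0 < μ U := (Measure.mem_support_iff_forall A).1 hA U (hU.mem_nhds hAU)
  have hs : μ.singularPart volume U = 0 := by
    rw [hμs, Measure.finsetSum_apply]
    refine Finset.sum_eq_zero fun i _ => ?_
    rw [Measure.smul_apply, Measure.dirac_apply' _ hU.measurableSet]
    have hi : M i ∉ U := fun hi => by
      have hatom : 0 < μ {M i} := by
        refine lt_of_lt_of_le ?_ (Measure.singularPart_le μ volume {M i})
        rw [hμs, Measure.finsetSum_apply]
        refine lt_of_lt_of_le ?_ (Finset.single_le_sum (fun _ _ => zero_le) (Finset.mem_univ i))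
        rw [Measure.smul_apply, Measure.dirac_apply_of_mem (Set.mem_singleton _), smul_eq_mul,
          mul_one]
        exact ENNReal.ofReal_pos.2 (hp i)
      have : M i ∈ U ∩ dominatedSupport μ K := ⟨hi, mem_dominatedSupport_of_atom hK hinv hatom⟩
      rw [hemp] at this
      exact this
    rw [Set.indicator_of_notMem hi, smul_zero]
  have hac : volume.withDensity (μ.rnDeriv volume) U = 0 := by
    have hsub : U ⊆ μ.supportᶜ ∪ frontier (coneMaps K) := fun X hX => by
      by_contra hX'
      rw [Set.mem_union, not_or, Set.mem_compl_iff, not_not] at hX'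
      have hXi : X ∈ interior (coneMaps K) := by
        by_contra hni
        exact hX'.2 ⟨subset_closure (hinv X hX'.1), hni⟩
      have : X ∈ U ∩ dominatedSupport μ K :=
        ⟨hX, mem_dominatedSupport_of_mem_interior hK hX'.1 hXi⟩
      rw [hemp] at this
      exact this
    refine measure_mono_null hsub (measure_union_null ?_ ?_)
    · exact nonpos_iff_eq_zero.1 ((Measure.withDensity_rnDeriv_le μ volume _).trans_eq
        (measure_compl_support_eq_zero μ))
    · exact withDensity_absolutelyContinuous _ _ (volume_frontier_eq_zero hK.convex_coneMaps)
  rw [← hdec, Measure.add_apply, hs, hac, add_zero] at hpos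
  exact lt_irrefl _ hpos

/-! ### From Lyapunov functions to decaying powers -/

/-- The infimum of `V` over the vectors that dominate `x` in the order given by `K`. -/
noncomputable def lowerEnvelope (K : Set (EuclideanSpace ℝ (Fin n)))
    (V : EuclideanSpace ℝ (Fin n) → ℝ) (x : EuclideanSpace ℝ (Fin n)) : ℝ :=
  sInf (V '' {y | y - x ∈ K})

theorem lowerEnvelope_le {K : Set (EuclideanSpace ℝ (Fin n))}
    {V : EuclideanSpace ℝ (Fin n) → ℝ} (hV : ∀ x, 0 ≤ V x) {x y : EuclideanSpace ℝ (Fin n)}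
    (h : y - x ∈ K) : lowerEnvelope K V x ≤ V y :=
  csInf_le ⟨0, by rintro _ ⟨z, -, rfl⟩; exact hV z⟩ ⟨y, h, rfl⟩

theorem IsProperCone.le_lowerEnvelope {K : Set (EuclideanSpace ℝ (Fin n))} (hK : IsProperCone K)
    {V : EuclideanSpace ℝ (Fin n) → ℝ} {x : EuclideanSpace ℝ (Fin n)} {a : ℝ}
    (h : ∀ y, y - x ∈ K → a ≤ V y) : a ≤ lowerEnvelope K V x :=
  le_csInf ⟨V x, x, by simpa using hK.zero_mem, rfl⟩ (by rintro _ ⟨y, hy, rfl⟩; exact h y hy)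

theorem IsProperCone.lowerEnvelope_nonneg {K : Set (EuclideanSpace ℝ (Fin n))}
    (hK : IsProperCone K) {V : EuclideanSpace ℝ (Fin n) → ℝ} (hV : ∀ x, 0 ≤ V x)
    (x : EuclideanSpace ℝ (Fin n)) : 0 ≤ lowerEnvelope K V x :=
  hK.le_lowerEnvelope fun y _ => hV y

theorem IsStochasticLyapunov.nonneg {μ : Measure (Matrix (Fin n) (Fin n) ℝ)} {p : ℕ} {γ : ℝ}
    {V : EuclideanSpace ℝ (Fin n) → ℝ} (h : IsStochasticLyapunov μ p γ V)
    (x : EuclideanSpace ℝ (Fin n)) : 0 ≤ V x := by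
  obtain ⟨C₁, C₂, h1, h2, hb⟩ := h.norm_bounds
  exact le_trans (by positivity) (hb x).1

/-- If `y ≥ x` and `X ≥ T`, then `X y ≥ X x ≥ T x`, so `V (X y)` is at least the envelope at `T x`.
Markov's inequality bounds the mean of `V (X y)` from below; then take the infimum over `y`. -/
theorem IsStochasticLyapunov.mul_lowerEnvelope_le {μ : Measure (Matrix (Fin n) (Fin n) ℝ)}
    [IsProbabilityMeasure μ] {K : Set (EuclideanSpace ℝ (Fin n))} (hK : IsProperCone K)
    (hinv : LeavesInvariant μ.support K) {p : ℕ} {γ : ℝ} {V : EuclideanSpace ℝ (Fin n) → ℝ}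
    (h : IsStochasticLyapunov μ p γ V) (T : Matrix (Fin n) (Fin n) ℝ)
    {x : EuclideanSpace ℝ (Fin n)} (hx : x ∈ K) :
    μ.real {X | X - T ∈ coneMaps K} * lowerEnvelope K V (T.toEuclideanLin x) ≤
      γ ^ p * lowerEnvelope K V x := by
  have hγ := h.rate_nonneg
  have key : ∀ y, y - x ∈ K →
      μ.real {X | X - T ∈ coneMaps K} * lowerEnvelope K V (T.toEuclideanLin x) ≤
        γ ^ p * V y := fun y hy => by
    refine le_trans ?_ (h.decrease y)
    refine le_trans ?_ (mul_meas_ge_le_integral_of_nonneg (Filter.Eventually.of_forall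
      fun X => h.nonneg _) (h.integrable y) (lowerEnvelope K V (T.toEuclideanLin x)))
    rw [mul_comm]
    refine mul_le_mul_of_nonneg_left ?_ (hK.lowerEnvelope_nonneg h.nonneg _)
    refine ENNReal.toReal_mono (measure_ne_top _ _) (measure_mono_ae ?_)
    have hae : ∀ᵐ X ∂μ, X ∈ μ.support := measure_compl_support_eq_zero μ
    filter_upwards [hae] with X hX hXT
    refine lowerEnvelope_le h.nonneg ?_
    have h1 := hK.add_mem (hinv X hX _ hy) (hXT x hx)
    rw [map_sub, map_sub, LinearMap.sub_apply, sub_add_sub_cancel] at h1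
    exact h1
  rcases (pow_nonneg hγ p).eq_or_lt with h0 | h0
  · have := key x (by simpa using hK.zero_mem)
    rw [← h0, zero_mul] at this ⊢
    exact this
  · rw [← div_le_iff₀' h0]
    exact hK.le_lowerEnvelope fun y hy => (div_le_iff₀' h0).2 (key y hy)

/-- What matters is the order of quantifiers: `c` is a product of probabilities, fixed before `p`,
`γ` and `V`. -/
theorem exists_mul_lowerEnvelope_transition_le {μ : Measure (Matrix (Fin n) (Fin n) ℝ)}
    [IsProbabilityMeasure μ] {K : Set (EuclideanSpace ℝ (Fin n))} (hK : IsProperCone K)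
    (hinv : LeavesInvariant μ.support K) {t : ℝ} (ht0 : 0 ≤ t) (ht1 : t < 1)
    {A : ℕ → Matrix (Fin n) (Fin n) ℝ} (hA : ∀ i, A i ∈ dominatedSupport μ K) (k : ℕ) :
    ∃ c : ℝ, 0 < c ∧ ∀ (p : ℕ) (γ : ℝ) (V : EuclideanSpace ℝ (Fin n) → ℝ),
      IsStochasticLyapunov μ p γ V → ∀ x ∈ K,
        c * lowerEnvelope K V ((t ^ k • transition A k).toEuclideanLin x) ≤
          (γ ^ p) ^ k * lowerEnvelope K V x := by
  induction k with
  | zero => exact ⟨1, one_pos, fun p γ V _ x _ => by simp [transition]⟩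
  | succ k ih =>
    obtain ⟨c, hc, ih⟩ := ih
    have hpos : 0 < μ.real {X | X - t • A k ∈ coneMaps K} :=
      ENNReal.toReal_pos ((hA k).2 t ht1).ne' (measure_ne_top _ _)
    refine ⟨c * μ.real {X | X - t • A k ∈ coneMaps K}, by positivity,
      fun p γ V hV x hx => ?_⟩
    have hmem : (t ^ k • transition A k).toEuclideanLin x ∈ K :=
      hK.smul_mem_coneMaps (transition_mem_coneMaps (fun i => hinv _ (hA i).1) k)
        (by positivity) x hx
    have h1 := hV.mul_lowerEnvelope_le hK hinv (t • A k) hmem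
    rw [← toEuclideanLin_mul_apply, smul_mul_smul_comm, ← pow_succ'] at h1
    rw [transition, mul_assoc]
    refine (mul_le_mul_of_nonneg_left h1 hc.le).trans ?_
    rw [mul_left_comm, pow_succ', mul_assoc]
    exact mul_le_mul_of_nonneg_left (ih p γ V hV x hx)
      (pow_nonneg hV.rate_nonneg p)

/-- Budget of exponents of `β`, after taking `p`-th roots and for each factor `B`: the Lyapunov rate
gains `4 * k`, the scaling `t = β ^ 2` costs `2 * k`, and the constant `c ≥ β ^ p` costs `1`. As `k
≥ 1`, at least `1` remains. -/
theorem powersDecay_transition {μ : Measure (Matrix (Fin n) (Fin n) ℝ)}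
    [IsProbabilityMeasure μ] {K : Set (EuclideanSpace ℝ (Fin n))} (hK : IsProperCone K)
    (hinv : LeavesInvariant μ.support K) {β : ℝ} (hβ0 : 0 < β) (hβ1 : β < 1)
    (hlyap : ∀ p : ℕ, 1 ≤ p → ∃ V γ, γ ≤ β ^ 4 ∧ IsStochasticLyapunov μ p γ V)
    {A : ℕ → Matrix (Fin n) (Fin n) ℝ} (hA : ∀ i, A i ∈ dominatedSupport μ K) {k : ℕ}
    (hk : 0 < k) : PowersDecay β (transition A k) := by
  obtain ⟨c, hc, hck⟩ := exists_mul_lowerEnvelope_transition_le hK hinv (t := β ^ 2)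
    (by positivity) (pow_lt_one₀ hβ0.le hβ1 two_ne_zero) hA k
  obtain ⟨p₀, hp₀⟩ := exists_pow_lt_of_lt_one hc hβ1
  set p := p₀ + 1
  have hp : β ^ p ≤ c := (pow_le_pow_of_le_one hβ0.le hβ1.le (Nat.le_succ p₀)).trans hp₀.le
  obtain ⟨V, γ, hγ, hV⟩ := hlyap p (Nat.le_add_left 1 p₀)
  have hγ0 := hV.rate_nonneg
  obtain ⟨C₁, C₂, hC₁, hC₂, hbounds⟩ := hV.norm_bounds
  obtain ⟨κ, hκ, hnormal⟩ := hK.exists_mul_norm_le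
  obtain ⟨s, hs, hspan⟩ := hK.exists_norm_le
  set B := transition A k
  have hB : B ∈ coneMaps K := transition_mem_coneMaps (fun i => hinv _ (hA i).1) k
  have hBm : ∀ m, ∀ x ∈ K, (B ^ m).toEuclideanLin x ∈ K := fun m => by
    induction m with
    | zero => intro x hx; rwa [pow_zero, toEuclideanLin_one_apply]
    | succ m ih =>
      intro x hx
      rw [pow_succ, toEuclideanLin_mul_apply]
      exact ih _ (hB x hx)
  have hiter : ∀ m, ∀ x ∈ K,
      c ^ m * lowerEnvelope K V ((((β ^ 2) ^ k • B) ^ m).toEuclideanLin x) ≤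
        ((γ ^ p) ^ k) ^ m * lowerEnvelope K V x := fun m => by
    induction m with
    | zero => intro x _; simp
    | succ m ih =>
      intro x hx
      have hx' := hK.smul_mem_coneMaps hB (c := (β ^ 2) ^ k) (by positivity) x hx
      have h1 := ih _ hx'
      rw [← toEuclideanLin_mul_apply, ← pow_succ] at h1
      have h2 := hck p γ V hV x hx
      calc _ = c * (c ^ m *
            lowerEnvelope K V ((((β ^ 2) ^ k • B) ^ (m + 1)).toEuclideanLin x)) := by ring
        _ ≤ c * (((γ ^ p) ^ k) ^ m *
            lowerEnvelope K V (((β ^ 2) ^ k • B).toEuclideanLin x)) := by gcongr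
        _ = ((γ ^ p) ^ k) ^ m *
            (c * lowerEnvelope K V (((β ^ 2) ^ k • B).toEuclideanLin x)) := by ring
        _ ≤ ((γ ^ p) ^ k) ^ m * ((γ ^ p) ^ k * lowerEnvelope K V x) := by gcongr
        _ = _ := by ring
  -- The maximum with `1` gives `M ≤ M ^ p`, so that the `p`-th root can be taken without real
  -- powers.
  set M : ℝ := max (C₂ / (C₁ * κ ^ p)) 1
  have hcone : ∀ m, ∀ x ∈ K, ‖(B ^ m).toEuclideanLin x‖ ≤ M * β ^ m * ‖x‖ := fun m x hx => by
    set y := (B ^ m).toEuclideanLin x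
    have hy : y ∈ K := hBm m x hx
    have hpow : (((β ^ 2) ^ k • B) ^ m).toEuclideanLin x = (β ^ (2 * k * m)) • y := by
      rw [smul_pow, map_smul, LinearMap.smul_apply, ← pow_mul, ← pow_mul,
        mul_assoc]
    have h1 := hiter m x hx
    rw [hpow] at h1
    have h2 : C₁ * (κ * (β ^ (2 * k * m) * ‖y‖)) ^ p ≤
        lowerEnvelope K V ((β ^ (2 * k * m)) • y) := by
      refine hK.le_lowerEnvelope fun z hz => le_trans ?_ (hbounds z).1
      have h3 := hnormal _ (hK.smul_mem (β ^ (2 * k * m)) (by positivity) y hy) z hz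
      rw [norm_smul, Real.norm_of_nonneg (by positivity)] at h3
      gcongr
    have h3 : lowerEnvelope K V x ≤ C₂ * ‖x‖ ^ p :=
      (lowerEnvelope_le hV.nonneg (by simpa using hK.zero_mem)).trans (hbounds x).2
    have h4 : β ^ (p * m) ≤ c ^ m := by
      rw [pow_mul]
      gcongr
    have h5 : ((γ ^ p) ^ k) ^ m ≤ β ^ (4 * p * k * m) := by
      rw [pow_mul, pow_mul, pow_mul]
      gcongr
    have h6 : β ^ (p * m) * (C₁ * (κ * (β ^ (2 * k * m) * ‖y‖)) ^ p) ≤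
        β ^ (4 * p * k * m) * (C₂ * ‖x‖ ^ p) :=
      calc _ ≤ c ^ m * lowerEnvelope K V ((β ^ (2 * k * m)) • y) := by gcongr
        _ ≤ _ := h1
        _ ≤ _ := by
          refine mul_le_mul h5 h3 (hK.lowerEnvelope_nonneg hV.nonneg x) (by positivity)
    -- This uses `k ≥ 1`. Of the exponent `2 * p * m`, half cancels the bound on `c ^ m` and half is
    -- the decay that is kept.
    have h7 : β ^ (4 * p * k * m) ≤ β ^ (2 * p * k * m) * β ^ (2 * p * m) := by
      rw [← pow_add]
      refine pow_le_pow_of_le_one hβ0.le hβ1.le ?_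
      nlinarith [Nat.mul_le_mul_left (2 * p * m) hk]
    have h8 : C₁ * κ ^ p * ‖y‖ ^ p ≤ C₂ * β ^ (p * m) * ‖x‖ ^ p := by
      have hpos : 0 < β ^ (p * m) * β ^ (2 * p * k * m) := by positivity
      refine le_of_mul_le_mul_left ?_ hpos
      calc _ = β ^ (p * m) * (C₁ * (κ * (β ^ (2 * k * m) * ‖y‖)) ^ p) := by
            rw [mul_pow, mul_pow, ← pow_mul]
            ring
        _ ≤ _ := h6
        _ ≤ β ^ (2 * p * k * m) * β ^ (2 * p * m) * (C₂ * ‖x‖ ^ p) := by gcongr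
        _ = _ := by ring
    have hM1 : 1 ≤ M := le_max_right _ _
    refine le_of_pow_le_pow_left₀ (Nat.succ_ne_zero p₀) (by positivity) ?_
    calc ‖y‖ ^ p ≤ C₂ / (C₁ * κ ^ p) * β ^ (p * m) * ‖x‖ ^ p := by
          rw [div_mul_eq_mul_div, div_mul_eq_mul_div, le_div_iff₀ (by positivity)]
          linarith
      _ ≤ M ^ p * β ^ (p * m) * ‖x‖ ^ p := by
          gcongr
          exact (le_max_left _ _).trans (le_self_pow₀ hM1 (Nat.succ_ne_zero p₀))
      _ = (M * β ^ m * ‖x‖) ^ p := by ring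
  refine ⟨s * M, fun m => norm_le_of_forall_toEuclideanLin_le (by positivity) fun x => ?_⟩
  rw [mul_assoc s]
  exact hspan _ (M * β ^ m) (by positivity) (hcone m) x

end SwitchedLinear

theorem mainTheorem2 (n : ℕ) (μ : Measure (Matrix (Fin n) (Fin n) ℝ)) [IsProbabilityMeasure μ]
    (hbdd : Bornology.IsBounded μ.support)
    (hcone : ∃ K : Set (EuclideanSpace ℝ (Fin n)),
      SwitchedLinear.IsProperCone K ∧ SwitchedLinear.LeavesInvariant μ.support K)
    (hsing : SwitchedLinear.SingularPartFinitelyAtomic μ) :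
    SwitchedLinear.AbsolutelyExponentiallyStable μ.support ↔
      ∃ γ : ℝ, γ < 1 ∧ ∀ p : ℕ, 1 ≤ p →
        ∃ (V : EuclideanSpace ℝ (Fin n) → ℝ) (γ' : ℝ), γ' ≤ γ ∧
          SwitchedLinear.IsStochasticLyapunov μ p γ' V := by
  rw [SwitchedLinear.absolutelyExponentiallyStable_iff]
  constructor
  · rintro ⟨c, hc0, hc1, hc⟩
    refine ⟨c, hc1, fun p _ => ?_⟩
    obtain ⟨V, hV⟩ := hc.exists_isStochasticLyapunov hc0 hc1 p
    exact ⟨V, c, le_rfl, hV⟩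
  · rintro ⟨γ, hγ, hlyap⟩
    obtain ⟨K, hK, hinv⟩ := hcone
    -- The maximum with `1 / 2` makes `β` positive even when `γ ≤ 0`.
    obtain ⟨β, hβ0, hβ4⟩ : ∃ β : ℝ, 0 < β ∧ β ^ 4 = max γ (1 / 2) :=
      ⟨max γ (1 / 2) ^ (((4 : ℕ) : ℝ)⁻¹), by positivity,
        Real.rpow_inv_natCast_pow (by positivity) (by norm_num)⟩
    have hβ1 : β < 1 := by
      by_contra! h
      have h1 : max γ (1 / 2) < 1 := max_lt hγ (by norm_num)
      have h2 := one_le_pow₀ h (n := 4)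
      linarith
    obtain ⟨c, hc0, hc1, hc⟩ := SwitchedLinear.exists_growthBound_lt_one
      (D := SwitchedLinear.dominatedSupport μ K) (hbdd.subset fun A hA => hA.1) hβ0 hβ1
      (fun A hA k hk => SwitchedLinear.powersDecay_transition hK hinv hβ0 hβ1
        (fun p hp => by
          obtain ⟨V, γ', hγ', hV⟩ := hlyap p hp
          exact ⟨V, γ', hβ4 ▸ hγ'.trans (le_max_left _ _), hV⟩) hA hk)
    obtain ⟨C, hC⟩ := hc.closure
    exact ⟨c, hc0, hc1, C, fun A hA =>
      hC A fun k => SwitchedLinear.support_subset_closure_dominatedSupport hK hinv hsing (hA k)⟩
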